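/- For $N\ge 1$ let $(z_1,\dots,z_N)\in\mathbb{C}^N$ be the eigenvalues of the $N\times N$ complex Ginibre ensemble, i.e. random points with joint law $$\frac{1}{Z_N}\prod_{1\le j<k\le N}|z_j-z_k|^2\prod_{i=1}^N e^{-N|z_i|^2}\,dm(z_i),$$ where $dm$ is Lebesgue measure on $\mathbb{C}$ and $Z_N$ is the normalizing constant (in particular $0<Z_N<\infty$), and let $\mathbb{E}$ denote the corresponding expectation. Let $G$ be the Barnes $G$-function, $$G(z+1)=(2\pi)^{z/2}e^{-\frac{z+z^2(1+\gamma_E)}{2}}\prod_{k=1}^\infty\Big(1+\frac zk\Big)^k e^{\frac{z^2}{2k}-z},$$ with $\gamma_E$ the Euler--Mascheroni constant. Let $C>0$. Then for all $N\ge 1$ and all $\gamma\in[0,C]$ the variable $\prod_{k=1}^N|z_k|^\gamma$ is integrable and $$\mathbb{E}\Big[\prod_{k=1}^N|z_k|^\gamma\Big]=N^{-N\gamma/2}\,\frac{G(N+1+\frac\gamma2)}{G(N+1)\,G(1+\frac\gamma2)}.$$ Moreover, uniformly in $\gamma\in[0,C]$, $$\mathbb{E}\Big[\prod_{k=1}^N|z_k|^\gamma\Big]=e^{-N\gamma/2}\,N^{\gamma^2/8}\,\frac{(2\pi)^{\gamma/4}}{G(1+\frac\gamma2)}\Big(1+O\Big(\frac1N\Big)\Big),$$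 that is, there is a constant $K$ depending only on $C$ such that for all $N\ge1$ and $\gamma\in[0,C]$ the error term is at most $K/N$ in absolute value. -/

import Mathlib

open MeasureTheory

noncomputable section

/-- The Barnes `G`-function at real arguments, given by its Weierstrass product
`G(z+1) = (2π)^{z/2} exp(-(z + z²(1+γ_E))/2) ∏_{k ≥ 1} (1 + z/k)^k exp(z²/(2k) - z)`,
where `γ_E` is the Euler-Mascheroni constant; here `w = z + 1`. -/
def barnesG (w : ℝ) : ℝ :=
  (2 * Real.pi) ^ ((w - 1) / 2) *
    Real.exp (-((w - 1) + (w - 1) ^ 2 * (1 + Real.eulerMascheroniConstant)) / 2) *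
    ∏' k : ℕ, ((1 + (w - 1) / ((k : ℝ) + 1)) ^ (k + 1) *
      Real.exp ((w - 1) ^ 2 / (2 * ((k : ℝ) + 1)) - (w - 1)))

/-- The one-particle weight `e^{-N V(z)} dm(z)` on `ℂ`, `dm` being Lebesgue measure. -/
def potentialWeight (N : ℕ) (V : ℂ → ℝ) : Measure ℂ :=
  volume.withDensity fun z => ENNReal.ofReal (Real.exp (-(N : ℝ) * V z))

/-- The unnormalized measure `∏_{j<k} |z_j - z_k|² ∏_i e^{-N V(z_i)} dm(z_i)` on `ℂ^N`. -/
def eigenvalueWeight (N : ℕ) (V : ℂ → ℝ) : Measure (Fin N → ℂ) :=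
  (Measure.pi fun _ : Fin N => potentialWeight N V).withDensity fun z =>
    ENNReal.ofReal (∏ j : Fin N, ∏ k ∈ Finset.Ioi j, ‖z j - z k‖ ^ 2)

/-- The joint law of the eigenvalues of the `N × N` random normal matrix with potential `V`:
`Z_{N,V}⁻¹ ∏_{j<k} |z_j - z_k|² ∏_i e^{-N V(z_i)} dm(z_i)`, where `Z_{N,V}` is the total mass. -/
def eigenvalueLaw (N : ℕ) (V : ℂ → ℝ) : Measure (Fin N → ℂ) :=
  (eigenvalueWeight N V Set.univ)⁻¹ • eigenvalueWeight N V

/-- The eigenvalue law of the complex Ginibre ensemble: the quadratic potential `V(z) = |z|²`. -/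
def ginibreLaw (N : ℕ) : Measure (Fin N → ℂ) :=
  eigenvalueLaw N fun z => ‖z‖ ^ 2

end

/-! The squared Vandermonde product is a determinant times its conjugate. By rotation invariance the
functions `z^a |z|^(γ/2)` are orthogonal for the Gaussian weight, so integrating the expanded
determinants leaves `N!` equal diagonal terms. Each is a product of radial moments, which are Gamma
values. Dividing by the case `γ = 0` gives `∏_{k<N} Γ(k+1+a)/Γ(k+1)` with `a = γ/2`
(`integral_prod_norm_rpow_ginibreLaw`).

The exact formula then telescopes from `G(w+1) = Γ(w) G(w)` (`barnesG_add_one`), which is derived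
from the Weierstrass product through Euler's limit for `Γ`, Stirling's formula and the definition of
`γ_E`.

The asymptotics need no expansion of `G` at infinity. Abel summation of the logarithm of the Gamma
product (`sum_logGammaShift`) produces the partial Weierstrass sum of `G(1+a)` itself. What remains
is `logError`, a sum of three explicit errors, each `O(1/N)` with a constant polynomial in `a`,
hence uniform for bounded `γ`. -/

/-! ### One-particle moments and orthogonality. -/

/-- The one-particle weight of the complex Ginibre ensemble. -/
noncomputable abbrev ginibreWeight (N : ℕ) : Measure ℂ := potentialWeight N fun z => ‖z‖ ^ 2

/-- The moment `∫ |z|^s e^{-N|z|²} dm(z)` in closed form. -/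
noncomputable def radialMoment (N : ℕ) (s : ℝ) : ℝ :=
  Real.pi * (N : ℝ) ^ (-(s / 2 + 1)) * Real.Gamma (s / 2 + 1)

theorem radialMoment_pos {N : ℕ} (hN : 1 ≤ N) {s : ℝ} (hs : 0 ≤ s) : 0 < radialMoment N s := by
  have : (0 : ℝ) < N := by exact_mod_cast hN
  have := Real.Gamma_pos_of_pos (show 0 < s / 2 + 1 by positivity)
  unfold radialMoment
  positivity

theorem measurable_ginibreDensity (N : ℕ) :
    Measurable fun z : ℂ => ENNReal.ofReal (Real.exp (-(N : ℝ) * ‖z‖ ^ 2)) := by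
  fun_prop

theorem integral_ginibreWeight {E : Type*} [NormedAddCommGroup E] [NormedSpace ℝ E] (N : ℕ)
    (g : ℂ → E) :
    ∫ z, g z ∂ginibreWeight N = ∫ z : ℂ, Real.exp (-(N : ℝ) * ‖z‖ ^ 2) • g z := by
  rw [ginibreWeight, potentialWeight, integral_withDensity_eq_integral_toReal_smul
    (measurable_ginibreDensity N) (by simp)]
  simp_rw [ENNReal.toReal_ofReal (Real.exp_pos _).le]

instance sigmaFinite_ginibreWeight (N : ℕ) : SigmaFinite (ginibreWeight N) := by
  unfold ginibreWeight potentialWeight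
  infer_instance

theorem integral_norm_rpow_ginibreWeight {N : ℕ} (hN : 1 ≤ N) {s : ℝ} (hs : 0 ≤ s) :
    ∫ z, ‖z‖ ^ s ∂ginibreWeight N = radialMoment N s := by
  have hN' : (0 : ℝ) < N := by exact_mod_cast hN
  have h := Complex.integral_rpow_mul_exp_neg_mul_rpow (p := 2) (q := s) (by norm_num)
    (by linarith) hN'
  rw [integral_ginibreWeight]
  simp_rw [smul_eq_mul, mul_comm (Real.exp _)]
  simp_rw [Real.rpow_two] at h
  rw [h, radialMoment, neg_div, add_div, div_self two_ne_zero]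
  ring

/-- A non-integrable function has Bochner integral `0` by convention, whereas the computed moment is
positive. -/
theorem integrable_norm_rpow_ginibreWeight {N : ℕ} (hN : 1 ≤ N) {s : ℝ} (hs : 0 ≤ s) :
    Integrable (fun z => ‖z‖ ^ s) (ginibreWeight N) := by
  by_contra h
  have h1 := integral_norm_rpow_ginibreWeight hN hs
  rw [integral_undef h] at h1
  exact (radialMoment_pos hN hs).ne h1

/-- The function `z^a \bar z^b |z|^γ`. -/
noncomputable def twistedMonomial (γ : ℝ) (a b : ℕ) (z : ℂ) : ℂ :=
  z ^ a * (starRingEnd ℂ z) ^ b * ((‖z‖ ^ γ : ℝ) : ℂ)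

theorem integrable_twistedMonomial {N : ℕ} (hN : 1 ≤ N) {γ : ℝ} (hγ : 0 ≤ γ) (a b : ℕ) :
    Integrable (twistedMonomial γ a b) (ginibreWeight N) := by
  refine (integrable_norm_rpow_ginibreWeight hN (s := a + b + γ) (by positivity)).mono' ?_ ?_
  · refine Measurable.aestronglyMeasurable ?_
    unfold twistedMonomial
    fun_prop
  · refine Filter.Eventually.of_forall fun z => le_of_eq ?_
    rw [twistedMonomial, norm_mul, norm_mul, norm_pow, norm_pow, RCLike.norm_conj,
      Complex.norm_real, Real.norm_of_nonneg (by positivity),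
      Real.rpow_add_of_nonneg (norm_nonneg z) (by positivity) hγ,
      Real.rpow_add_of_nonneg (norm_nonneg z) (by positivity) (by positivity),
      Real.rpow_natCast, Real.rpow_natCast]

theorem integral_twistedMonomial_self {N : ℕ} (hN : 1 ≤ N) {γ : ℝ} (hγ : 0 ≤ γ) (a : ℕ) :
    ∫ z, twistedMonomial γ a a z ∂ginibreWeight N = (radialMoment N (2 * a + γ) : ℂ) := by
  rw [← integral_norm_rpow_ginibreWeight hN (by positivity), ← integral_complex_ofReal]
  congr 1 with z
  rw [twistedMonomial, ← mul_pow, Complex.mul_conj, Complex.normSq_eq_norm_sq,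
    Real.rpow_add_of_nonneg (norm_nonneg z) (by positivity) hγ, Real.rpow_mul (norm_nonneg z),
    Real.rpow_two, Real.rpow_natCast]
  push_cast
  ring

/-- Rotation by the angle `π/(a-b)` preserves the weight and multiplies the integrand by `e^{iπ} =
-1`, so the integral equals its own negative. -/
theorem integral_twistedMonomial_of_ne (N : ℕ) (γ : ℝ) {a b : ℕ} (hab : a ≠ b) :
    ∫ z, twistedMonomial γ a b z ∂ginibreWeight N = 0 := by
  have hd : ((a : ℝ) - b) ≠ 0 := sub_ne_zero.2 (by exact_mod_cast hab)
  set c : Circle := Circle.exp (Real.pi / (a - b)) with hc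
  have hrot : ∀ z, twistedMonomial γ a b (rotation c z) = -twistedMonomial γ a b z := by
    intro z
    have hcc : (c : ℂ) ^ a * (starRingEnd ℂ (c : ℂ)) ^ b = -1 := by
      rw [← Circle.coe_inv_eq_conj, hc, ← Circle.exp_neg, Circle.coe_exp, Circle.coe_exp,
        ← Complex.exp_nat_mul, ← Complex.exp_nat_mul, ← Complex.exp_add, ← Complex.exp_pi_mul_I]
      congr 1
      have : ((a : ℂ) - b) ≠ 0 := by exact_mod_cast hd
      push_cast
      field_simp
      ring
    have hn : ‖(c : ℂ) * z‖ = ‖z‖ := by rw [norm_mul, Circle.norm_coe, one_mul]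
    simp only [twistedMonomial, rotation_apply, hn, map_mul, mul_pow]
    linear_combination (z ^ a * (starRingEnd ℂ z) ^ b * ((‖z‖ ^ γ : ℝ) : ℂ)) * hcc
  rw [integral_ginibreWeight]
  have h := (LinearIsometryEquiv.measurePreserving (rotation c)).integral_comp
    (rotation c).toHomeomorph.measurableEmbedding
    (fun z : ℂ => Real.exp (-(N : ℝ) * ‖z‖ ^ 2) • twistedMonomial γ a b z)
  simp only [LinearIsometryEquiv.norm_map, hrot, smul_neg, integral_neg] at h
  exact self_eq_neg.1 h.symm

theorem integral_twistedMonomial {N : ℕ} (hN : 1 ≤ N) {γ : ℝ} (hγ : 0 ≤ γ) (a b : ℕ) :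
    ∫ z, twistedMonomial γ a b z ∂ginibreWeight N =
      if a = b then (radialMoment N (2 * a + γ) : ℂ) else 0 := by
  split_ifs with h
  · rw [← h, integral_twistedMonomial_self hN hγ]
  · exact integral_twistedMonomial_of_ne N γ h

/-! ### Vandermonde expansion and the `N`-particle integral. -/

theorem prod_norm_sub_sq_eq_sum {n : ℕ} (z : Fin n → ℂ) :
    ((∏ j : Fin n, ∏ k ∈ Finset.Ioi j, ‖z j - z k‖ ^ 2 : ℝ) : ℂ) =
      ∑ σ : Equiv.Perm (Fin n), ∑ τ : Equiv.Perm (Fin n),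
        ((Equiv.Perm.sign σ : ℤ) : ℂ) * ((Equiv.Perm.sign τ : ℤ) : ℂ) *
          ∏ i, (z i ^ (σ i : ℕ) * (starRingEnd ℂ (z i)) ^ (τ i : ℕ)) := by
  have hdet : ∀ w : Fin n → ℂ, ∏ j : Fin n, ∏ k ∈ Finset.Ioi j, (w k - w j) =
      ∑ σ : Equiv.Perm (Fin n), ((Equiv.Perm.sign σ : ℤ) : ℂ) * ∏ i, w i ^ (σ i : ℕ) := by
    intro w
    rw [← Matrix.det_vandermonde, ← Matrix.det_transpose, Matrix.det_apply']
    simp [Matrix.vandermonde]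
  have h : ((∏ j : Fin n, ∏ k ∈ Finset.Ioi j, ‖z j - z k‖ ^ 2 : ℝ) : ℂ) =
      (∏ j : Fin n, ∏ k ∈ Finset.Ioi j, (z k - z j)) *
        ∏ j : Fin n, ∏ k ∈ Finset.Ioi j, (starRingEnd ℂ (z k) - starRingEnd ℂ (z j)) := by
    push_cast
    simp_rw [← Finset.prod_mul_distrib]
    refine Finset.prod_congr rfl fun j _ => Finset.prod_congr rfl fun k _ => ?_
    rw [← map_sub, Complex.mul_conj, Complex.normSq_eq_norm_sq, norm_sub_rev]
    push_cast
    rfl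
  rw [h, hdet, hdet fun i => starRingEnd ℂ (z i), Finset.sum_mul_sum]
  refine Finset.sum_congr rfl fun σ _ => Finset.sum_congr rfl fun τ _ => ?_
  rw [Finset.prod_mul_distrib]
  ring

/-- Each term of the double permutation sum factorizes over the particles. If `σ ≠ τ`, some factor
vanishes by orthogonality; if `σ = τ`, the signs cancel and reindexing by `σ` gives a value
independent of `σ`. -/
theorem integral_prod_norm_rpow_eigenvalueWeight {N : ℕ} (hN : 1 ≤ N) {γ : ℝ} (hγ : 0 ≤ γ) :
    ∫ z : Fin N → ℂ, ∏ k, ‖z k‖ ^ γ ∂eigenvalueWeight N (fun z => ‖z‖ ^ 2) =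
      (N.factorial : ℝ) * ∏ k : Fin N, radialMoment N (2 * (k : ℕ) + γ) := by
  have hmeas : Measurable fun z : Fin N → ℂ =>
      ENNReal.ofReal (∏ j : Fin N, ∏ k ∈ Finset.Ioi j, ‖z j - z k‖ ^ 2) := by fun_prop
  rw [eigenvalueWeight, integral_withDensity_eq_integral_toReal_smul hmeas (by simp)]
  have hnn : ∀ z : Fin N → ℂ, 0 ≤ ∏ j : Fin N, ∏ k ∈ Finset.Ioi j, ‖z j - z k‖ ^ 2 :=
    fun z => Finset.prod_nonneg fun j _ => Finset.prod_nonneg fun k _ => by positivity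
  simp_rw [ENNReal.toReal_ofReal (hnn _)]
  have hexp : ∀ z : Fin N → ℂ,
      (((∏ j : Fin N, ∏ k ∈ Finset.Ioi j, ‖z j - z k‖ ^ 2) • ∏ k, ‖z k‖ ^ γ : ℝ) : ℂ) =
      ∑ σ : Equiv.Perm (Fin N), ∑ τ : Equiv.Perm (Fin N),
        ((Equiv.Perm.sign σ : ℤ) : ℂ) * ((Equiv.Perm.sign τ : ℤ) : ℂ) *
          ∏ i, twistedMonomial γ (σ i) (τ i) (z i) := by
    intro z
    rw [smul_eq_mul, Complex.ofReal_mul, prod_norm_sub_sq_eq_sum, Finset.sum_mul]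
    refine Finset.sum_congr rfl fun σ _ => ?_
    rw [Finset.sum_mul]
    refine Finset.sum_congr rfl fun τ _ => ?_
    simp only [twistedMonomial]
    rw [Finset.prod_mul_distrib (g := fun i => ((‖z i‖ ^ γ : ℝ) : ℂ)), Complex.ofReal_prod]
    ring
  have hint : ∀ σ τ : Equiv.Perm (Fin N), Integrable (fun z : Fin N → ℂ =>
      ((Equiv.Perm.sign σ : ℤ) : ℂ) * ((Equiv.Perm.sign τ : ℤ) : ℂ) *
          ∏ i, twistedMonomial γ (σ i) (τ i) (z i)) (Measure.pi fun _ => ginibreWeight N) :=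
    fun σ τ => (Integrable.fintype_prod (f := fun i => twistedMonomial γ (σ i) (τ i))
      fun i => integrable_twistedMonomial hN hγ _ _).const_mul _
  rw [← Complex.ofReal_inj, ← integral_complex_ofReal]
  simp_rw [hexp]
  rw [integral_finsetSum _ fun σ _ => integrable_finsetSum _ fun τ _ => hint σ τ]
  have hterm : ∀ σ : Equiv.Perm (Fin N), ∫ z : Fin N → ℂ, ∑ τ : Equiv.Perm (Fin N),
      ((Equiv.Perm.sign σ : ℤ) : ℂ) * ((Equiv.Perm.sign τ : ℤ) : ℂ) *
        ∏ i, twistedMonomial γ (σ i) (τ i) (z i) ∂(Measure.pi fun _ => ginibreWeight N) =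
      ((∏ k : Fin N, radialMoment N (2 * (k : ℕ) + γ) : ℝ) : ℂ) := by
    intro σ
    rw [integral_finsetSum _ fun τ _ => hint σ τ, Finset.sum_eq_single σ]
    · rw [integral_const_mul, integral_fintype_prod_eq_prod
        (fun i => twistedMonomial γ (σ i) (σ i))]
      simp_rw [integral_twistedMonomial hN hγ, if_true]
      rw [Equiv.prod_comp σ fun k : Fin N => (radialMoment N (2 * (k : ℕ) + γ) : ℂ),
        ← Int.cast_mul, Int.units_coe_mul_self]
      push_cast
      ring
    · intro τ _ hτ
      obtain ⟨i, hi⟩ : ∃ i, σ i ≠ τ i := by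
        by_contra! h
        exact hτ (Equiv.ext fun i => (h i).symm)
      rw [integral_const_mul, integral_fintype_prod_eq_prod
        (fun i => twistedMonomial γ (σ i) (τ i)), Finset.prod_eq_zero (Finset.mem_univ i), mul_zero]
      rw [integral_twistedMonomial hN hγ, if_neg (by rwa [Fin.val_inj])]
    · simp
  rw [Finset.sum_congr rfl fun σ _ => hterm σ]
  simp [Fintype.card_perm]

theorem prod_radialMoment_pos {N : ℕ} (hN : 1 ≤ N) {γ : ℝ} (hγ : 0 ≤ γ) :
    0 < (N.factorial : ℝ) * ∏ k : Fin N, radialMoment N (2 * (k : ℕ) + γ) :=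
  mul_pos (by exact_mod_cast N.factorial_pos)
    (Finset.prod_pos fun k _ => radialMoment_pos hN (by positivity))

theorem integrable_prod_norm_rpow_eigenvalueWeight {N : ℕ} (hN : 1 ≤ N) {γ : ℝ} (hγ : 0 ≤ γ) :
    Integrable (fun z : Fin N → ℂ => ∏ k, ‖z k‖ ^ γ) (eigenvalueWeight N fun z => ‖z‖ ^ 2) := by
  by_contra h
  have h1 := integral_prod_norm_rpow_eigenvalueWeight hN hγ
  rw [integral_undef h] at h1
  exact (prod_radialMoment_pos hN hγ).ne h1

/-- At `γ = 0` the integrand is the constant `1`, so its integrability is finiteness of the mass. -/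
theorem isFiniteMeasure_eigenvalueWeight {N : ℕ} (hN : 1 ≤ N) :
    IsFiniteMeasure (eigenvalueWeight N fun z => ‖z‖ ^ 2) := by
  have h := integrable_prod_norm_rpow_eigenvalueWeight hN le_rfl
  simpa [integrable_const_iff] using h

theorem eigenvalueWeight_real_univ {N : ℕ} (hN : 1 ≤ N) :
    (eigenvalueWeight N fun z => ‖z‖ ^ 2).real Set.univ =
      (N.factorial : ℝ) * ∏ k : Fin N, radialMoment N (2 * (k : ℕ)) := by
  have h := integral_prod_norm_rpow_eigenvalueWeight hN le_rfl
  simpa using h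

theorem eigenvalueWeight_univ_ne_zero {N : ℕ} (hN : 1 ≤ N) :
    eigenvalueWeight N (fun z => ‖z‖ ^ 2) Set.univ ≠ 0 := by
  intro h
  have h1 := eigenvalueWeight_real_univ hN
  have h2 := prod_radialMoment_pos hN le_rfl
  rw [measureReal_def, h, ENNReal.toReal_zero] at h1
  simp only [add_zero] at h2
  exact h2.ne h1

theorem isProbabilityMeasure_ginibreLaw {N : ℕ} (hN : 1 ≤ N) :
    IsProbabilityMeasure (ginibreLaw N) := by
  have := isFiniteMeasure_eigenvalueWeight hN
  refine ⟨?_⟩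
  rw [ginibreLaw, eigenvalueLaw, Measure.smul_apply, smul_eq_mul]
  exact ENNReal.inv_mul_cancel (eigenvalueWeight_univ_ne_zero hN) (measure_ne_top _ _)

theorem integrable_prod_norm_rpow_ginibreLaw {N : ℕ} (hN : 1 ≤ N) {γ : ℝ} (hγ : 0 ≤ γ) :
    Integrable (fun z : Fin N → ℂ => ∏ k, ‖z k‖ ^ γ) (ginibreLaw N) :=
  (integrable_prod_norm_rpow_eigenvalueWeight hN hγ).smul_measure
    (ENNReal.inv_ne_top.2 (eigenvalueWeight_univ_ne_zero hN))

theorem integral_prod_norm_rpow_ginibreLaw {N : ℕ} (hN : 1 ≤ N) {γ : ℝ} (hγ : 0 ≤ γ) :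
    ∫ z : Fin N → ℂ, ∏ k, ‖z k‖ ^ γ ∂ginibreLaw N =
      (N : ℝ) ^ (-((N : ℝ) * (γ / 2))) *
        ∏ k ∈ Finset.range N, (Real.Gamma (k + 1 + γ / 2) / Real.Gamma (k + 1)) := by
  have hN' : (0 : ℝ) < N := by exact_mod_cast hN
  rw [ginibreLaw, eigenvalueLaw, integral_smul_measure, ENNReal.toReal_inv, ← measureReal_def,
    eigenvalueWeight_real_univ hN, integral_prod_norm_rpow_eigenvalueWeight hN hγ, smul_eq_mul,
    Fin.prod_univ_eq_prod_range (fun k => radialMoment N (2 * (k : ℕ))),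
    Fin.prod_univ_eq_prod_range (fun k => radialMoment N (2 * (k : ℕ) + γ)), inv_mul_eq_div,
    mul_div_mul_left _ _ (by exact_mod_cast N.factorial_ne_zero), ← Finset.prod_div_distrib]
  have hk : ∀ k : ℕ, radialMoment N (2 * (k : ℕ) + γ) / radialMoment N (2 * (k : ℕ)) =
      (N : ℝ) ^ (-(γ / 2)) * (Real.Gamma (k + 1 + γ / 2) / Real.Gamma (k + 1)) := by
    intro k
    have h1 : -((2 * (k : ℝ) + γ) / 2 + 1) = -(γ / 2) + -((2 * (k : ℝ)) / 2 + 1) := by ring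
    have h2 : (2 * (k : ℝ) + γ) / 2 + 1 = k + 1 + γ / 2 := by ring
    have h3 : (2 * (k : ℝ)) / 2 + 1 = k + 1 := by ring
    rw [radialMoment, radialMoment, h1, Real.rpow_add hN', h2, h3]
    have := Real.Gamma_pos_of_pos (show (0 : ℝ) < k + 1 by positivity)
    have := Real.rpow_pos_of_pos hN' (-((k : ℝ) + 1))
    field_simp
  simp_rw [hk]
  rw [Finset.prod_mul_distrib, Finset.prod_const, Finset.card_range, ← Real.rpow_natCast,
    ← Real.rpow_mul hN'.le]
  congr 2
  ring

/-! ### Elementary comparison and logarithm inequalities. -/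

open Filter Topology

/-- Both `v + u` and `v - u` decrease to `0` from index `1` on, hence are nonnegative there. This
turns bounds on increments into bounds on tails. -/
theorem abs_le_of_abs_succ_sub_le {u v : ℕ → ℝ} (hu : Tendsto u atTop (𝓝 0))
    (hv : Tendsto v atTop (𝓝 0)) (h : ∀ n, 1 ≤ n → |u (n + 1) - u n| ≤ v n - v (n + 1))
    {n : ℕ} (hn : 1 ≤ n) : |u n| ≤ v n := by
  obtain ⟨m, rfl⟩ : ∃ m, n = m + 1 := ⟨n - 1, by omega⟩
  have h1 : Antitone fun m => v (m + 1) + u (m + 1) := antitone_nat_of_succ_le fun m => by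
    have := abs_le.1 (h (m + 1) (by omega))
    linarith [this.2]
  have h2 : Antitone fun m => v (m + 1) - u (m + 1) := antitone_nat_of_succ_le fun m => by
    have := abs_le.1 (h (m + 1) (by omega))
    linarith [this.1]
  have h3 := h1.le_of_tendsto ((hv.add hu).comp (tendsto_add_atTop_nat 1)) m
  have h4 := h2.le_of_tendsto ((hv.sub hu).comp (tendsto_add_atTop_nat 1)) m
  rw [abs_le]
  constructor <;> linarith

theorem sub_sq_half_le_log_one_add {x : ℝ} (hx : 0 ≤ x) : x - x ^ 2 / 2 ≤ Real.log (1 + x) := by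
  have hd : ∀ y ∈ Set.Ici (0 : ℝ), HasDerivAt (fun y : ℝ => Real.log (1 + y) - (y - y ^ 2 / 2))
      (y ^ 2 / (1 + y)) y := by
    intro y hy
    have hy' : 1 + y ≠ 0 := by linarith [Set.mem_Ici.1 hy]
    have := (((hasDerivAt_id y).const_add 1).log hy').sub
      ((hasDerivAt_id y).sub (((hasDerivAt_id y).pow 2).div_const 2))
    convert! this using 1
    simp only [id]
    field_simp
    ring
  have hm : MonotoneOn (fun y : ℝ => Real.log (1 + y) - (y - y ^ 2 / 2)) (Set.Ici 0) := by
    refine monotoneOn_of_deriv_nonneg (convex_Ici 0)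
      (fun y hy => (hd y hy).continuousAt.continuousWithinAt)
      (fun y hy => (hd y (interior_subset hy)).differentiableAt.differentiableWithinAt)
      fun y hy => ?_
    have : 0 ≤ y := interior_subset hy
    rw [(hd y this).deriv]
    positivity
  have := hm (Set.mem_Ici.2 le_rfl) (Set.mem_Ici.2 hx) hx
  norm_num at this
  linarith

theorem log_one_add_le_sub_sq_half_add {x : ℝ} (hx : 0 ≤ x) :
    Real.log (1 + x) ≤ x - x ^ 2 / 2 + x ^ 3 / 3 := by
  have hd : ∀ y ∈ Set.Ici (0 : ℝ), HasDerivAt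
      (fun y : ℝ => y - y ^ 2 / 2 + y ^ 3 / 3 - Real.log (1 + y)) (y ^ 3 / (1 + y)) y := by
    intro y hy
    have hy' : 1 + y ≠ 0 := by linarith [Set.mem_Ici.1 hy]
    have := (((hasDerivAt_id y).sub (((hasDerivAt_id y).pow 2).div_const 2)).add
      (((hasDerivAt_id y).pow 3).div_const 3)).sub (((hasDerivAt_id y).const_add 1).log hy')
    convert! this using 1
    simp only [id]
    field_simp
    ring
  have hm : MonotoneOn (fun y : ℝ => y - y ^ 2 / 2 + y ^ 3 / 3 - Real.log (1 + y))
      (Set.Ici 0) := by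
    refine monotoneOn_of_deriv_nonneg (convex_Ici 0)
      (fun y hy => (hd y hy).continuousAt.continuousWithinAt)
      (fun y hy => (hd y (interior_subset hy)).differentiableAt.differentiableWithinAt)
      fun y hy => ?_
    have : 0 ≤ y := interior_subset hy
    rw [(hd y this).deriv]
    positivity
  have := hm (Set.mem_Ici.2 le_rfl) (Set.mem_Ici.2 hx) hx
  norm_num at this
  linarith

/-! ### The Barnes function and its functional equation. -/

/-- The logarithm of the `k`-th Weierstrass factor of `G(1 + z)`. -/
noncomputable def barnesLogFactor (z : ℝ) (k : ℕ) : ℝ :=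
  ((k : ℝ) + 1) * Real.log (1 + z / (k + 1)) + (z ^ 2 / (2 * ((k : ℝ) + 1)) - z)

theorem barnesLogFactor_nonneg {z : ℝ} (hz : 0 ≤ z) (k : ℕ) : 0 ≤ barnesLogFactor z k := by
  have hk : (0 : ℝ) < k + 1 := by positivity
  have h := mul_le_mul_of_nonneg_left
    (sub_sq_half_le_log_one_add (x := z / (k + 1)) (by positivity)) hk.le
  have e : ((k : ℝ) + 1) * (z / (k + 1) - (z / (k + 1)) ^ 2 / 2) =
    -(z ^ 2 / (2 * ((k : ℝ) + 1)) - z) := by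
    field_simp
    ring
  rw [e] at h
  unfold barnesLogFactor
  linarith

theorem barnesLogFactor_le {z : ℝ} (hz : 0 ≤ z) (k : ℕ) :
    barnesLogFactor z k ≤ z ^ 3 / 3 * (1 / ((k : ℝ) + 1) ^ 2) := by
  have hk : (0 : ℝ) < k + 1 := by positivity
  have h := mul_le_mul_of_nonneg_left
    (log_one_add_le_sub_sq_half_add (x := z / (k + 1)) (by positivity)) hk.le
  have e : ((k : ℝ) + 1) * (z / (k + 1) - (z / (k + 1)) ^ 2 / 2 + (z / (k + 1)) ^ 3 / 3) =
    -(z ^ 2 / (2 * ((k : ℝ) + 1)) - z) + z ^ 3 / 3 * (1 / ((k : ℝ) + 1) ^ 2) := by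
    field_simp
    ring
  rw [e] at h
  unfold barnesLogFactor
  linarith

theorem summable_barnesLogFactor {z : ℝ} (hz : 0 ≤ z) : Summable (barnesLogFactor z) := by
  refine Summable.of_nonneg_of_le (barnesLogFactor_nonneg hz) (barnesLogFactor_le hz) ?_
  refine Summable.mul_left _ ?_
  have h := (summable_nat_add_iff 1).2 (Real.summable_one_div_nat_pow.2 (one_lt_two))
  exact_mod_cast h

/-- The logarithm of `G(1 + z)`, for `z ≥ 0`. -/
noncomputable def barnesLog (z : ℝ) : ℝ :=
  z / 2 * Real.log (2 * Real.pi) - (z + z ^ 2 * (1 + Real.eulerMascheroniConstant)) / 2 +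
    ∑' k, barnesLogFactor z k

/-- For `z ≥ 0` all Weierstrass factors are positive with summable logarithms, so the infinite
product is the exponential of their sum. -/
theorem barnesG_one_add {z : ℝ} (hz : 0 ≤ z) : barnesG (1 + z) = Real.exp (barnesLog z) := by
  have hpos : ∀ k : ℕ, 0 < 1 + z / ((k : ℝ) + 1) := fun k => by positivity
  have hfac : ∀ k : ℕ, Real.log ((1 + z / ((k : ℝ) + 1)) ^ (k + 1) *
      Real.exp (z ^ 2 / (2 * ((k : ℝ) + 1)) - z)) = barnesLogFactor z k := by
    intro k
    rw [Real.log_mul (pow_pos (hpos k) _).ne' (Real.exp_pos _).ne', Real.log_pow, Real.log_exp,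
      barnesLogFactor]
    push_cast
    rfl
  have hsum := summable_barnesLogFactor hz
  simp_rw [← funext hfac] at hsum
  rw [barnesG, add_sub_cancel_left, ← Real.rexp_tsum_eq_tprod
    (fun k => mul_pos (pow_pos (hpos k) _) (Real.exp_pos _)) hsum, Real.rpow_def_of_pos
    (by positivity), ← Real.exp_add, ← Real.exp_add, barnesLog]
  simp_rw [hfac]
  congr 1
  ring

theorem barnesLog_zero : barnesLog 0 = 0 := by
  simp [barnesLog, barnesLogFactor]

theorem sum_barnesLogFactor_sub {z : ℝ} (hz : 0 < z) (n : ℕ) :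
    ∑ k ∈ Finset.range n, barnesLogFactor z k - ∑ k ∈ Finset.range n, barnesLogFactor (z - 1) k =
      ((n : ℝ) + 1) * Real.log (z + n) - ∑ m ∈ Finset.range (n + 1), Real.log (z + m) +
        (z - 1 / 2) * harmonic n - n := by
  induction n with
  | zero => simp
  | succ n ih =>
    have hn : (0 : ℝ) < (n : ℝ) + 1 := by positivity
    have h1 : Real.log (1 + z / (n + 1)) = Real.log (z + (n + 1)) - Real.log (n + 1) := by
      rw [← Real.log_div (by positivity) hn.ne']
      congr 1
      field_simp
      ring
    have h2 : Real.log (1 + (z - 1) / (n + 1)) = Real.log (z + n) - Real.log (n + 1) := by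
      rw [← Real.log_div (by positivity) hn.ne']
      congr 1
      field_simp
      ring
    rw [Finset.sum_range_succ, Finset.sum_range_succ, Finset.sum_range_succ _ (n + 1), harmonic_succ,
      barnesLogFactor, barnesLogFactor, h1, h2]
    push_cast
    have e : z ^ 2 / (2 * ((n : ℝ) + 1)) - (z - 1) ^ 2 / (2 * ((n : ℝ) + 1)) =
        (z - 1 / 2) * ((n : ℝ) + 1)⁻¹ := by
      field_simp
      ring
    linear_combination ih + e

theorem tendsto_harmonic_sub_log' : Tendsto (fun n : ℕ => (harmonic n : ℝ) - Real.log n) atTop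
    (𝓝 Real.eulerMascheroniConstant) := by
  refine Real.tendsto_eulerMascheroniSeq'.congr' ?_
  filter_upwards [eventually_ne_atTop 0] with n hn
  simp [Real.eulerMascheroniSeq', hn]

/-- In the limit of `sum_barnesLogFactor_sub`, the sum of `log (z + m)` yields `log Γ(z)` by Euler's
formula, the harmonic number yields `γ_E`, and Stirling's formula for the remaining `log n!` yields
`log (2π)`. -/
theorem barnesLog_eq_add {z : ℝ} (hz : 1 ≤ z) :
    barnesLog z = Real.log (Real.Gamma z) + barnesLog (z - 1) := by
  have hz0 : 0 < z := by linarith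
  have hA := ((summable_barnesLogFactor hz0.le).hasSum.tendsto_sum_nat).sub
    ((summable_barnesLogFactor (z := z - 1) (by linarith)).hasSum.tendsto_sum_nat)
  have hlog : Tendsto (fun n : ℕ => (n : ℝ) * Real.log (1 + z / n)) atTop (𝓝 z) :=
    (Real.tendsto_mul_log_one_add_div_atTop z).comp tendsto_natCast_atTop_atTop
  have hlog0 : Tendsto (fun n : ℕ => Real.log (1 + z / n)) atTop (𝓝 0) := by
    have h1 : Tendsto (fun n : ℕ => 1 + z / (n : ℝ)) atTop (𝓝 1) := by
      simpa using (tendsto_const_div_atTop_nhds_zero_nat z).const_add 1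
    simpa using h1.log one_ne_zero
  have hst := Stirling.tendsto_stirlingSeq_sqrt_pi.log (by positivity)
  have hB := ((((Real.BohrMollerup.tendsto_log_gamma hz0).add (hlog.add hlog0)).add
    (tendsto_harmonic_sub_log'.const_mul (z - 1 / 2))).sub hst).sub_const (1 / 2 * Real.log 2)
  have hAB := tendsto_nhds_unique hA (hB.congr' ?_)
  · have e1 : Real.log (√Real.pi) = 1 / 2 * Real.log Real.pi := by
      rw [Real.log_sqrt Real.pi_pos.le]; ring
    have e2 : Real.log (2 * Real.pi) = Real.log 2 + Real.log Real.pi :=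
      Real.log_mul two_ne_zero Real.pi_pos.ne'
    rw [barnesLog, barnesLog, e2]
    rw [e1] at hAB
    linear_combination hAB
  · filter_upwards [eventually_ge_atTop 1] with n hn
    have hn' : (0 : ℝ) < n := by exact_mod_cast hn
    have h1 : Real.log (1 + z / n) = Real.log (z + n) - Real.log n := by
      rw [← Real.log_div (by positivity) hn'.ne']
      congr 1
      field_simp
      ring
    have h2 := Stirling.log_stirlingSeq_formula n
    rw [Real.log_mul two_ne_zero hn'.ne', Real.log_div hn'.ne' (Real.exp_pos 1).ne',
      Real.log_exp] at h2
    rw [sum_barnesLogFactor_sub hz0, h1, h2, Real.BohrMollerup.logGammaSeq]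
    ring

theorem barnesG_add_one {w : ℝ} (hw : 1 ≤ w) : barnesG (w + 1) = Real.Gamma w * barnesG w := by
  have h1 := barnesG_one_add (z := w) (by linarith)
  have h2 := barnesG_one_add (z := w - 1) (by linarith)
  rw [add_sub_cancel] at h2
  rw [add_comm w 1, h1, h2, barnesLog_eq_add hw, Real.exp_add,
    Real.exp_log (Real.Gamma_pos_of_pos (by linarith))]

theorem barnesG_pos {w : ℝ} (hw : 1 ≤ w) : 0 < barnesG w := by
  have h2 := barnesG_one_add (z := w - 1) (by linarith)
  rw [add_sub_cancel] at h2
  rw [h2]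
  exact Real.exp_pos _

theorem barnesG_one : barnesG 1 = 1 := by
  have h := barnesG_one_add (z := 0) le_rfl
  rwa [add_zero, barnesLog_zero, Real.exp_zero] at h

theorem prod_Gamma_div_Gamma {a : ℝ} (ha : 0 ≤ a) (N : ℕ) :
    ∏ k ∈ Finset.range N, (Real.Gamma (k + 1 + a) / Real.Gamma (k + 1)) =
      barnesG ((N : ℝ) + 1 + a) / (barnesG ((N : ℝ) + 1) * barnesG (1 + a)) := by
  induction N with
  | zero =>
    have := barnesG_pos (w := 1 + a) (by linarith)
    simp [barnesG_one, this.ne']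
  | succ N ih =>
    have hN : (0 : ℝ) ≤ N := N.cast_nonneg
    rw [Finset.prod_range_succ, ih]
    push_cast
    rw [show (N : ℝ) + 1 + 1 + a = (N + 1 + a) + 1 by ring, barnesG_add_one (w := N + 1 + a)
      (by linarith), barnesG_add_one (w := N + 1) (by linarith)]
    have := barnesG_pos (w := N + 1) (by linarith)
    have := barnesG_pos (w := 1 + a) (by linarith)
    have := Real.Gamma_pos_of_pos (show (0 : ℝ) < N + 1 by positivity)
    field_simp

/-! ### Asymptotics with explicit errors. -/

theorem log_Gamma_add_one {x : ℝ} (hx : 0 < x) :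
    Real.log (Real.Gamma (x + 1)) = Real.log (Real.Gamma x) + Real.log x := by
  rw [Real.Gamma_add_one hx.ne', Real.log_mul hx.ne' (Real.Gamma_pos_of_pos hx).ne', add_comm]

/-- The logarithm of `Γ(n + 1 + a) / Γ(n + 1)`. -/
noncomputable def logGammaShift (a : ℝ) (n : ℕ) : ℝ :=
  Real.log (Real.Gamma (n + 1 + a)) - Real.log (Real.Gamma (n + 1))

theorem logGammaShift_succ {a : ℝ} (ha : 0 ≤ a) (n : ℕ) :
    logGammaShift a (n + 1) = logGammaShift a n + Real.log (1 + a / (n + 1)) := by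
  have hn : (0 : ℝ) < (n : ℝ) + 1 := by positivity
  have h1 : Real.log (1 + a / (n + 1)) = Real.log (n + 1 + a) - Real.log (n + 1) := by
    rw [← Real.log_div (by positivity) hn.ne']
    congr 1
    field_simp
  rw [logGammaShift, logGammaShift, h1]
  push_cast
  rw [log_Gamma_add_one hn, show (n : ℝ) + 1 + 1 + a = (n + 1 + a) + 1 by ring,
    log_Gamma_add_one (x := n + 1 + a) (by positivity)]
  ring

theorem tendsto_logGammaShift_sub {a : ℝ} (ha : 0 ≤ a) :
    Tendsto (fun n : ℕ => logGammaShift a n - a * Real.log n) atTop (𝓝 0) := by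
  have hlog0 : Tendsto (fun n : ℕ => Real.log (1 + (1 + a) / n)) atTop (𝓝 0) := by
    have h1 : Tendsto (fun n : ℕ => 1 + (1 + a) / (n : ℝ)) atTop (𝓝 1) := by
      simpa using (tendsto_const_div_atTop_nhds_zero_nat (1 + a)).const_add 1
    simpa using h1.log one_ne_zero
  -- Euler's sequence at `1 + a` gives `log Γ(n+2+a) - (1+a) log n - log n!`; subtracting `log (1 +
  -- (1+a)/n)`, which tends to `0`, removes the extra factor `n+1+a` and one `log n`.
  have h := ((Real.BohrMollerup.tendsto_log_gamma (x := 1 + a) (by linarith)).const_sub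
    (Real.log (Real.Gamma (1 + a)))).sub hlog0
  rw [sub_self, sub_zero] at h
  refine h.congr' ?_
  filter_upwards [eventually_ge_atTop 1] with n hn
  have hn' : (0 : ℝ) < n := by exact_mod_cast hn
  have h1 : Real.log (1 + (1 + a) / n) = Real.log (n + 1 + a) - Real.log n := by
    rw [← Real.log_div (by positivity) hn'.ne']
    congr 1
    field_simp
    ring
  have h2 := Real.BohrMollerup.f_add_nat_eq (f := fun x => Real.log (Real.Gamma x)) (x := 1 + a)
    log_Gamma_add_one (by linarith) (n + 1)
  have h3 := log_Gamma_add_one (x := n + 1 + a) (by positivity)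
  push_cast at h2
  rw [show 1 + a + ((n : ℝ) + 1) = n + 1 + a + 1 by ring, h3] at h2
  rw [h1, Real.BohrMollerup.logGammaSeq, logGammaShift, Real.Gamma_nat_eq_factorial]
  linear_combination (-1 : ℝ) * h2

/-- The `1/n` term is kept because Abel summation multiplies this quantity by `N`, and the product
must still be `O(1/N)`. The increments are `O(1/n^3)`, which telescoping differences of `1/n^2`
dominate. -/
theorem abs_logGammaShift_sub_le {a : ℝ} (ha : 0 ≤ a) {n : ℕ} (hn : 1 ≤ n) :
    |logGammaShift a n - a * Real.log n - (a ^ 2 + a) / 2 * (1 / n)| ≤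
      2 * (a + a ^ 2 + a ^ 3) * (1 / (n : ℝ) ^ 2) := by
  have hinv : Tendsto (fun n : ℕ => 1 / (n : ℝ)) atTop (𝓝 0) :=
    tendsto_const_div_atTop_nhds_zero_nat 1
  have hinv2 : Tendsto (fun n : ℕ => 1 / (n : ℝ) ^ 2) atTop (𝓝 0) := by
    simpa using hinv.pow 2
  refine abs_le_of_abs_succ_sub_le
    (u := fun n : ℕ => logGammaShift a n - a * Real.log n - (a ^ 2 + a) / 2 * (1 / n))
    (v := fun n : ℕ => 2 * (a + a ^ 2 + a ^ 3) * (1 / (n : ℝ) ^ 2)) ?_ ?_ (fun m hm => ?_) hn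
  · simpa using (tendsto_logGammaShift_sub ha).sub (hinv.const_mul ((a ^ 2 + a) / 2))
  · simpa using hinv2.const_mul (2 * (a + a ^ 2 + a ^ 3))
  · have hm' : (1 : ℝ) ≤ m := by exact_mod_cast hm
    have hm0 : (0 : ℝ) < m := by linarith
    generalize hM : (m : ℝ) = M at *
    have h1 : Real.log (M + 1) = Real.log M + Real.log (1 + 1 / M) := by
      rw [← Real.log_mul hm0.ne' (by positivity)]
      congr 1
      field_simp
    have hs := logGammaShift_succ ha m
    rw [hM] at hs
    push_cast
    rw [hM, hs, h1]
    have l1 := sub_sq_half_le_log_one_add (x := a / (M + 1)) (by positivity)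
    have l2 := log_one_add_le_sub_sq_half_add (x := a / (M + 1)) (by positivity)
    have l3 := mul_le_mul_of_nonneg_left
      (sub_sq_half_le_log_one_add (x := 1 / M) (by positivity)) ha
    have l4 := mul_le_mul_of_nonneg_left
      (log_one_add_le_sub_sq_half_add (x := 1 / M) (by positivity)) ha
    -- The coefficient `(a^2 + a)/2` is the one that cancels all terms of order `1/M^2`.
    have e : a / (M + 1) - (a / (M + 1)) ^ 2 / 2 - a * (1 / M - (1 / M) ^ 2 / 2) -
        (a ^ 2 + a) / 2 * (1 / (M + 1) - 1 / M) =
        a / 2 * (1 / M ^ 2 * (1 / (M + 1))) + a ^ 2 / 2 * (1 / M * (1 / (M + 1)) ^ 2) := by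
      field_simp
      ring
    have b1 : 1 / M ^ 2 * (1 / (M + 1)) ≤ 1 / M ^ 3 := by
      calc 1 / M ^ 2 * (1 / (M + 1)) ≤ 1 / M ^ 2 * (1 / M) := by gcongr; linarith
        _ = 1 / M ^ 3 := by field_simp
    have b2 : 1 / M * (1 / (M + 1)) ^ 2 ≤ 1 / M ^ 3 := by
      calc 1 / M * (1 / (M + 1)) ^ 2 ≤ 1 / M * (1 / M) ^ 2 := by gcongr; linarith
        _ = 1 / M ^ 3 := by field_simp
    have b3 : (a / (M + 1)) ^ 3 ≤ a ^ 3 * (1 / M ^ 3) := by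
      calc (a / (M + 1)) ^ 3 ≤ (a / M) ^ 3 := by gcongr; linarith
        _ = a ^ 3 * (1 / M ^ 3) := by field_simp
    have b4 : a * (1 / M) ^ 3 = a * (1 / M ^ 3) := by rw [one_div_pow]
    -- This is the source of the factor `2` in the final constant.
    have b5 : 1 / M ^ 3 ≤ 2 * (1 / M ^ 2 - 1 / (M + 1) ^ 2) := by
      have e5 : 2 * (1 / M ^ 2 - 1 / (M + 1) ^ 2) = 2 * (2 * M + 1) / (M ^ 2 * (M + 1) ^ 2) := by
        field_simp
        ring
      rw [e5, div_le_div_iff₀ (by positivity) (by positivity)]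
      have : 0 ≤ M ^ 2 * (3 * M ^ 2 - 1) := by
        have : 1 ≤ M ^ 2 := one_le_pow₀ hm'
        exact mul_nonneg (by positivity) (by linarith)
      nlinarith
    have hK : (a + a ^ 2 + a ^ 3) * (1 / M ^ 3) ≤
        (a + a ^ 2 + a ^ 3) * (2 * (1 / M ^ 2 - 1 / (M + 1) ^ 2)) := by gcongr
    have p1 : 0 ≤ a / 2 * (1 / M ^ 2 * (1 / (M + 1))) := by positivity
    have p2 : 0 ≤ a ^ 2 / 2 * (1 / M * (1 / (M + 1)) ^ 2) := by positivity
    have c1 := mul_le_mul_of_nonneg_left b1 (show 0 ≤ a / 2 by positivity)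
    have c2 := mul_le_mul_of_nonneg_left b2 (show 0 ≤ a ^ 2 / 2 by positivity)
    have t1 : 0 ≤ a * (1 / M ^ 3) := by positivity
    have t2 : 0 ≤ a ^ 2 * (1 / M ^ 3) := by positivity
    have t3 : 0 ≤ a ^ 3 * (1 / M ^ 3) := by positivity
    rw [abs_le]
    constructor <;> linarith

theorem abs_tsum_barnesLogFactor_sub_sum_le {a : ℝ} (ha : 0 ≤ a) {n : ℕ} (hn : 1 ≤ n) :
    |∑' k, barnesLogFactor a k - ∑ k ∈ Finset.range n, barnesLogFactor a k| ≤
      a ^ 3 * (1 / n) := by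
  have hinv : Tendsto (fun n : ℕ => 1 / (n : ℝ)) atTop (𝓝 0) :=
    tendsto_const_div_atTop_nhds_zero_nat 1
  refine abs_le_of_abs_succ_sub_le
    (u := fun n : ℕ => ∑' k, barnesLogFactor a k - ∑ k ∈ Finset.range n, barnesLogFactor a k)
    (v := fun n : ℕ => a ^ 3 * (1 / (n : ℝ))) ?_ ?_ (fun m hm => ?_) hn
  · simpa using (summable_barnesLogFactor ha).hasSum.tendsto_sum_nat.const_sub
      (∑' k, barnesLogFactor a k)
  · simpa using hinv.const_mul (a ^ 3)
  · have hm0 : (0 : ℝ) < m := by exact_mod_cast hm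
    have h1 : 1 / ((m : ℝ) + 1) ^ 2 ≤ 1 / m - 1 / (m + 1) := by
      have e : 1 / (m : ℝ) - 1 / (m + 1) = 1 / (m * (m + 1)) := by
        field_simp
        ring
      rw [e]
      apply one_div_le_one_div_of_le (by positivity)
      nlinarith
    have h2 := mul_le_mul_of_nonneg_left h1 (show 0 ≤ a ^ 3 by positivity)
    have h3 := barnesLogFactor_nonneg ha m
    have h4 := barnesLogFactor_le ha m
    have h5 : 0 ≤ a ^ 3 * (1 / ((m : ℝ) + 1) ^ 2) := by positivity
    rw [Finset.sum_range_succ]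
    push_cast
    rw [abs_le]
    constructor <;> linarith

theorem abs_harmonic_sub_log_sub_le {n : ℕ} (hn : 1 ≤ n) :
    |(harmonic n : ℝ) - Real.log n - Real.eulerMascheroniConstant| ≤ 1 / n := by
  have hn0 : (0 : ℝ) < n := by exact_mod_cast hn
  have h1 := Real.eulerMascheroniSeq_lt_eulerMascheroniConstant n
  have h2 := Real.eulerMascheroniConstant_lt_eulerMascheroniSeq' n
  rw [Real.eulerMascheroniSeq] at h1
  rw [Real.eulerMascheroniSeq', if_neg (by omega)] at h2
  have h3 : Real.log (n + 1) = Real.log n + Real.log (1 + 1 / n) := by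
    rw [← Real.log_mul hn0.ne' (by positivity)]
    congr 1
    field_simp
  have h4 := Real.log_le_sub_one_of_pos (show (0 : ℝ) < 1 + 1 / n by positivity)
  rw [abs_le]
  constructor <;> linarith

/-- Abel summation: the increments, weighted by `k + 1`, are `(k+1) log (1 + a/(k+1))`, which is the
`k`-th logarithmic Weierstrass factor up to `a - a^2/(2(k+1))`. -/
theorem sum_logGammaShift {a : ℝ} (ha : 0 ≤ a) (N : ℕ) :
    ∑ k ∈ Finset.range N, logGammaShift a k =
      N * logGammaShift a N - ∑ k ∈ Finset.range N, barnesLogFactor a k +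
        a ^ 2 / 2 * harmonic N - a * N := by
  induction N with
  | zero => simp
  | succ N ih =>
    rw [Finset.sum_range_succ, Finset.sum_range_succ, ih, logGammaShift_succ ha, harmonic_succ,
      barnesLogFactor]
    have : (0 : ℝ) < (N : ℝ) + 1 := by positivity
    push_cast
    field_simp
    ring

theorem prod_Gamma_div_Gamma_eq_exp {a : ℝ} (ha : 0 ≤ a) (N : ℕ) :
    ∏ k ∈ Finset.range N, (Real.Gamma (k + 1 + a) / Real.Gamma (k + 1)) =
      Real.exp (∑ k ∈ Finset.range N, logGammaShift a k) := by
  rw [Real.exp_sum]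
  refine Finset.prod_congr rfl fun k _ => ?_
  rw [logGammaShift, Real.exp_sub, Real.exp_log (Real.Gamma_pos_of_pos (by positivity)),
    Real.exp_log (Real.Gamma_pos_of_pos (by positivity))]

/-- The logarithm of the ratio of `N^{-Na} ∏_{k<N} Γ(k+1+a)/Γ(k+1)` to its leading asymptotics. -/
noncomputable def logError (a : ℝ) (N : ℕ) : ℝ :=
  N * (logGammaShift a N - a * Real.log N - (a ^ 2 + a) / 2 * (1 / N)) +
    (∑' k, barnesLogFactor a k - ∑ k ∈ Finset.range N, barnesLogFactor a k) +
    a ^ 2 / 2 * (harmonic N - Real.log N - Real.eulerMascheroniConstant)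

theorem abs_logError_le {a : ℝ} (ha : 0 ≤ a) {N : ℕ} (hN : 1 ≤ N) :
    |logError a N| ≤ (2 * a + 3 * a ^ 2 + 3 * a ^ 3) / N := by
  have hN0 : (0 : ℝ) < N := by exact_mod_cast hN
  have h1 := mul_le_mul_of_nonneg_left (abs_logGammaShift_sub_le ha hN) hN0.le
  have h2 := abs_tsum_barnesLogFactor_sub_sum_le ha hN
  have h3 := mul_le_mul_of_nonneg_left (abs_harmonic_sub_log_sub_le hN)
    (show 0 ≤ a ^ 2 / 2 by positivity)
  rw [← abs_of_pos hN0, ← abs_mul, abs_of_pos hN0] at h1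
  rw [← abs_of_nonneg (show 0 ≤ a ^ 2 / 2 by positivity), ← abs_mul,
    abs_of_nonneg (show 0 ≤ a ^ 2 / 2 by positivity)] at h3
  refine (abs_add_three _ _ _).trans ((add_le_add (add_le_add h1 h2) h3).trans ?_)
  have e : (N : ℝ) * (2 * (a + a ^ 2 + a ^ 3) * (1 / (N : ℝ) ^ 2)) + a ^ 3 * (1 / N) +
      a ^ 2 / 2 * (1 / N) = (2 * a + 5 / 2 * a ^ 2 + 3 * a ^ 3) / N := by
    field_simp
    ring
  rw [e]
  gcongr
  norm_num

/-- An exact identity of exponents: the constant `(a^2 + a)/2` and the `γ_E` term split off in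
`logError` are those in the prefactor of `1/G(1+a)`, and `(a^2/2) log N` comes from the harmonic
number. -/
theorem rpow_mul_prod_Gamma_div_Gamma {a : ℝ} (ha : 0 ≤ a) {N : ℕ} (hN : 1 ≤ N) :
    (N : ℝ) ^ (-((N : ℝ) * a)) *
        ∏ k ∈ Finset.range N, (Real.Gamma (k + 1 + a) / Real.Gamma (k + 1)) =
      Real.exp (-((N : ℝ) * a)) * (N : ℝ) ^ (a ^ 2 / 2) *
        ((2 * Real.pi) ^ (a / 2) / barnesG (1 + a)) * Real.exp (logError a N) := by
  have hN0 : (0 : ℝ) < N := by exact_mod_cast hN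
  rw [prod_Gamma_div_Gamma_eq_exp ha, barnesG_one_add ha, Real.rpow_def_of_pos hN0,
    Real.rpow_def_of_pos hN0, Real.rpow_def_of_pos (by positivity), ← Real.exp_sub,
    ← Real.exp_add, ← Real.exp_add, ← Real.exp_add, ← Real.exp_add, sum_logGammaShift ha,
    barnesLog, logError]
  congr 1
  field_simp
  ring

theorem abs_exp_sub_one_le_mul_exp_abs (x : ℝ) : |Real.exp x - 1| ≤ |x| * Real.exp |x| := by
  have h1 := Real.add_one_le_exp x
  have h2 := Real.add_one_le_exp (-x)
  have h3 : Real.exp x * Real.exp (-x) = 1 := by rw [← Real.exp_add, add_neg_cancel, Real.exp_zero]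
  have h4 := Real.exp_pos x
  rcases le_total 0 x with hx | hx
  · rw [abs_of_nonneg hx, abs_of_nonneg (by linarith)]
    nlinarith
  · have h5 : 1 ≤ Real.exp |x| := Real.one_le_exp (abs_nonneg x)
    rw [abs_of_nonpos (by linarith [Real.exp_le_one_iff.2 hx])]
    rw [abs_of_nonpos hx] at h5 ⊢
    nlinarith

theorem mainTheorem8 (C : ℝ) (hC : 0 < C) :
    (∀ N : ℕ, 1 ≤ N → IsProbabilityMeasure (ginibreLaw N)) ∧
    (∀ N : ℕ, 1 ≤ N → ∀ γ ∈ Set.Icc (0 : ℝ) C,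
      Integrable (fun z : Fin N → ℂ => ∏ k : Fin N, ‖z k‖ ^ γ) (ginibreLaw N) ∧
      ∫ z : Fin N → ℂ, ∏ k : Fin N, ‖z k‖ ^ γ ∂(ginibreLaw N) =
        (N : ℝ) ^ (-((N : ℝ) * (γ / 2))) *
          (barnesG ((N : ℝ) + 1 + γ / 2) / (barnesG ((N : ℝ) + 1) * barnesG (1 + γ / 2)))) ∧
    (∃ K : ℝ, ∀ N : ℕ, 1 ≤ N → ∀ γ ∈ Set.Icc (0 : ℝ) C, ∃ ε : ℝ, |ε| ≤ K / (N : ℝ) ∧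
      ∫ z : Fin N → ℂ, ∏ k : Fin N, ‖z k‖ ^ γ ∂(ginibreLaw N) =
        Real.exp (-((N : ℝ) * (γ / 2))) * (N : ℝ) ^ (γ ^ 2 / 8) *
          ((2 * Real.pi) ^ (γ / 4) / barnesG (1 + γ / 2)) * (1 + ε)) := by
  refine ⟨fun N hN => isProbabilityMeasure_ginibreLaw hN, fun N hN γ hγ =>
    ⟨integrable_prod_norm_rpow_ginibreLaw hN hγ.1, ?_⟩, ?_⟩
  · rw [integral_prod_norm_rpow_ginibreLaw hN hγ.1,
      prod_Gamma_div_Gamma (show 0 ≤ γ / 2 by linarith [hγ.1])]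
  · set A : ℝ := 2 * (C / 2) + 3 * (C / 2) ^ 2 + 3 * (C / 2) ^ 3 with hA
    have hA0 : 0 ≤ A := by positivity
    -- `A/N` bounds `logError` for every `γ ≤ C`, by monotonicity in `a`; `|e^x - 1| ≤ |x| e^{|x|}`
    -- with `|x| ≤ A/N ≤ A` then gives `K = A e^A`.
    refine ⟨A * Real.exp A, fun N hN γ hγ =>
      ⟨Real.exp (logError (γ / 2) N) - 1, ?_, ?_⟩⟩
    · have hN1 : (1 : ℝ) ≤ N := by exact_mod_cast hN
      have hγ0 : 0 ≤ γ := hγ.1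
      have hle : |logError (γ / 2) N| ≤ A / N := by
        refine (abs_logError_le (show 0 ≤ γ / 2 by linarith) hN).trans ?_
        have hγC : γ ≤ C := hγ.2
        rw [hA]
        gcongr
      have hle' : |logError (γ / 2) N| ≤ A := hle.trans (div_le_self hA0 hN1)
      calc |Real.exp (logError (γ / 2) N) - 1|
          ≤ |logError (γ / 2) N| * Real.exp |logError (γ / 2) N| :=
            abs_exp_sub_one_le_mul_exp_abs _
        _ ≤ A / N * Real.exp A := by gcongr
        _ = A * Real.exp A / N := by ring
    · rw [integral_prod_norm_rpow_ginibreLaw hN hγ.1,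
        rpow_mul_prod_Gamma_div_Gamma (show 0 ≤ γ / 2 by linarith [hγ.1]) hN,
        add_sub_cancel, show (γ / 2) ^ 2 / 2 = γ ^ 2 / 8 by ring,
        show γ / 2 / 2 = γ / 4 by ring]
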